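/- Let $\Omega$ be a Hausdorff topological space with its Borel $\sigma$-field $\mathfrak B$, and let $\Theta$ be the set of all probability measures on $(\Omega,\mathfrak B)$. The $\tau$-topology on $\Theta$ is the coarsest topology for which $P\mapsto P(B)$ is continuous for every $B\in\mathfrak B$; $\mathrm{cl}_\tau(\Psi)$ denotes the closure of $\Psi\subset\Theta$ in this topology, and $\Psi$ is called relatively $\tau$-compact if $\mathrm{cl}_\tau(\Psi)$ is $\tau$-compact. Let $\Theta_0,\Theta_1\subset\Theta$. From an i.i.d. sample $X_1,\dots,X_n$ with common law $P$ one tests the hypothesis $H_0: P\in\Theta_0$ against the alternative $H_1: P\in\Theta_1$. A test based on $n$ observations is a function $K_n:\Omega^n\to[0,1]$, measurable for the product $\sigma$-field, whose value is the probability of rejecting $H_0$. Put $$\alpha(K_n)=\sup_{P\in\Theta_0}\int K_n\,dP^{\otimes n},\qquad \beta(K_n)=\sup_{P\in\Theta_1}\int (1-K_n)\,dP^{\otimes n}$$ (a supremum over the empty set being $0$). $H_0$ and $H_1$ are called distinguishable if for every $a\in(0,1)$ there are tests $K_n$, $n\ge 1$, with $\alpha(K_n)<a$ for all $n\ge1$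 and $\lim_{n\to\infty}\beta(K_n)=0$. They are called indistinguishable if $\alpha(K_n)+\beta(K_n)\ge 1$ for every $n\ge 1$ and every test $K_n$ based on $n$ observations. (i) If $\Theta_0$ and $\Theta_1$ are both relatively $\tau$-compact and $\mathrm{cl}_\tau(\Theta_0)\cap\mathrm{cl}_\tau(\Theta_1)\neq\emptyset$, then $H_0$ and $H_1$ are indistinguishable. (ii) If $\Theta_0$ or $\Theta_1$ is relatively $\tau$-compact and $\mathrm{cl}_\tau(\Theta_0)\cap\mathrm{cl}_\tau(\Theta_1)=\emptyset$, then $H_0$ and $H_1$ are distinguishable; moreover, there exist tests $K_n$ ($n\ge 1$) and constants $c>0$ and $n_0$ such that for all $n>n_0$ $$\alpha(K_n)\le e^{-cn}\quad\text{and}\quad \beta(K_n)\le e^{-cn}.$$ -/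

import Mathlib

open MeasureTheory Filter Topology

noncomputable section

namespace SetwiseTesting

variable {Ω : Type*} [MeasurableSpace Ω]

/-- The τ-topology (topology of setwise convergence) on the set of all probability measures:
the coarsest topology making `P ↦ P(B)` continuous for every measurable set `B`. It is passed
explicitly below, since Mathlib's instance on `ProbabilityMeasure Ω` is the topology of weak
convergence. -/
@[reducible] def tauTopology (Ω : Type*) [MeasurableSpace Ω] : TopologicalSpace (ProbabilityMeasure Ω) :=
  ⨅ (B : Set Ω) (_ : MeasurableSet B),
    TopologicalSpace.induced (fun P : ProbabilityMeasure Ω => (P : Measure Ω).real B) inferInstance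

/-- The closure in the τ-topology. -/
def tauClosure (Ψ : Set (ProbabilityMeasure Ω)) : Set (ProbabilityMeasure Ω) :=
  @closure _ (tauTopology Ω) Ψ

/-- Relative compactness in the τ-topology: the τ-closure is τ-compact. -/
def IsTauRelativelyCompact (Ψ : Set (ProbabilityMeasure Ω)) : Prop :=
  @IsCompact _ (tauTopology Ω) (tauClosure Ψ)

/-- The law of an i.i.d. sample `X₁, …, Xₙ` from `P`, on `Ωⁿ` with the product σ-field. -/
def sampleLaw (n : ℕ) (P : ProbabilityMeasure Ω) : Measure (Fin n → Ω) :=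
  Measure.pi fun _ => (P : Measure Ω)

/-- A (possibly randomized) test from a sample of size `n`; its value at a sample is the
probability of rejecting the hypothesis. -/
structure SampleTest (Ω : Type*) [MeasurableSpace Ω] (n : ℕ) where
  /-- the probability of rejection -/
  toFun : (Fin n → Ω) → ℝ
  measurable_toFun : Measurable toFun
  nonneg : ∀ x, 0 ≤ toFun x
  le_one : ∀ x, toFun x ≤ 1

/-- Type I error probability at `P`: the expected probability of rejection. -/
def typeIError {n : ℕ} (K : SampleTest Ω n) (P : ProbabilityMeasure Ω) : ℝ :=
  ∫ x, K.toFun x ∂(sampleLaw n P)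

/-- Type II error probability at `P`: the expected probability of acceptance. -/
def typeIIError {n : ℕ} (K : SampleTest Ω n) (P : ProbabilityMeasure Ω) : ℝ :=
  ∫ x, (1 - K.toFun x) ∂(sampleLaw n P)

/-- `α(K)`, the supremum of the type I errors over the hypothesis. The errors lie in `[0, 1]`,
so this is a genuine supremum (and `0` over the empty set). -/
def supTypeI (Θ₀ : Set (ProbabilityMeasure Ω)) {n : ℕ} (K : SampleTest Ω n) : ℝ :=
  ⨆ P : Θ₀, typeIError K P

/-- `β(K)`, the supremum of the type II errors over the alternative. -/
def supTypeII (Θ₁ : Set (ProbabilityMeasure Ω)) {n : ℕ} (K : SampleTest Ω n) : ℝ :=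
  ⨆ P : Θ₁, typeIIError K P

/-- The hypothesis and the alternative are distinguishable: for every level `0 < a < 1` there are
tests `K n`, based on `n` observations, of level `α(K n) < a`, with `β(K n) → 0`. -/
def Distinguishable (Θ₀ Θ₁ : Set (ProbabilityMeasure Ω)) : Prop :=
  ∀ a : ℝ, 0 < a → a < 1 → ∃ K : (n : ℕ) → SampleTest Ω n,
    (∀ n, 1 ≤ n → supTypeI Θ₀ (K n) < a) ∧
      Tendsto (fun n => supTypeII Θ₁ (K n)) atTop (𝓝 0)

/-- The hypothesis and the alternative are indistinguishable: for every sample size, every test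
satisfies `α(K) + β(K) ≥ 1`. -/
def Indistinguishable (Θ₀ Θ₁ : Set (ProbabilityMeasure Ω)) : Prop :=
  ∀ n : ℕ, 1 ≤ n → ∀ K : SampleTest Ω n, 1 ≤ supTypeI Θ₀ K + supTypeII Θ₁ K

end SetwiseTesting

end

/-! (i) On a τ-compact family, `P ↦ ∫ K dP^{⊗n}` is τ-continuous. Compactness gives, as in Dini's
theorem, smallness of `P (A k)` uniformly in `P` when `A k ↓ ∅`; this passes to product measures
(`exists_sampleLaw_le_of_sequence`), and a π-λ argument then gives continuity
(`continuousOn_sampleLaw_real`). At a common point `P` of the closures, `α ≥ ∫ K dP^{⊗n}` and `β ≥ 1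
- ∫ K dP^{⊗n}`.

(ii) If the closures are disjoint and one is compact, finitely many sets separate the families by a
fixed `ε` (`uniformlySeparated_of_isCompact_of_isClosed`). Hoeffding's inequality for the empirical
frequencies of these sets makes a minimum-distance test exponentially good. -/

namespace SetwiseTesting

variable {Ω : Type*} [MeasurableSpace Ω]

/-! ### Uniform continuity at the empty set, and its passage to product measures -/

/-- A family of probability measures is uniformly continuous at the empty set if `P (A k) → 0`
uniformly over the family whenever the measurable sets `A k` decrease to the empty set. -/
def UniformlyContinuousAtEmpty (M : Set (ProbabilityMeasure Ω)) : Prop :=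
  ∀ A : ℕ → Set Ω, (∀ k, MeasurableSet (A k)) → Antitone A → ⋂ k, A k = ∅ →
    ∀ ε : ENNReal, 0 < ε → ∃ k, ∀ P ∈ M, (P : Measure Ω) (A k) ≤ ε

instance (n : ℕ) (P : ProbabilityMeasure Ω) : IsProbabilityMeasure (sampleLaw n P) := by
  unfold sampleLaw; infer_instance

lemma continuous_real_tau {B : Set Ω} (hB : MeasurableSet B) :
    Continuous[tauTopology Ω, inferInstance]
      (fun P : ProbabilityMeasure Ω => (P : Measure Ω).real B) :=
  continuous_iff_le_induced.2 (iInf₂_le B hB)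

lemma uniformlyContinuousAtEmpty_of_isCompact {M : Set (ProbabilityMeasure Ω)}
    (hM : @IsCompact _ (tauTopology Ω) M) : UniformlyContinuousAtEmpty M := by
  let _ := tauTopology Ω
  intro A hA hanti hempty ε hε
  obtain ⟨δ, hδ, hδε⟩ : ∃ δ : ℝ, 0 < δ ∧ ENNReal.ofReal δ ≤ ε := by
    rcases eq_or_ne ε ⊤ with rfl | h
    · exact ⟨1, one_pos, le_top⟩
    · exact ⟨ε.toReal, ENNReal.toReal_pos hε.ne' h, ENNReal.ofReal_toReal_le⟩
  obtain ⟨k, hk⟩ := hM.elim_directed_cover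
    (fun k => {P : ProbabilityMeasure Ω | (P : Measure Ω).real (A k) < δ})
    (fun k => isOpen_Iio.preimage (continuous_real_tau (hA k)))
    (fun P _ => by
      have h := tendsto_measure_iInter_atTop (μ := (P : Measure Ω))
        (fun k => (hA k).nullMeasurableSet) hanti ⟨0, measure_ne_top _ _⟩
      rw [hempty, measure_empty] at h
      obtain ⟨k, hk⟩ := (h.eventually_lt_const (ENNReal.ofReal_pos.2 hδ)).exists
      exact Set.mem_iUnion.2 ⟨k, ENNReal.toReal_lt_of_lt_ofReal hk⟩)
    (Monotone.directed_le fun i j hij P hP =>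
      (measureReal_mono (hanti hij)).trans_lt hP)
  refine ⟨k, fun P hP => le_trans ?_ hδε⟩
  exact ENNReal.le_ofReal_iff_toReal_le (measure_ne_top _ _) hδ.le |>.2 (hk hP).le

/-- Induction on `n` by Fubini. Working with a sequence of measures keeps the supremum `g k` of the
section masses measurable; by the induction hypothesis the sets `{g k > ε / 2}` decrease to `∅`. -/
lemma exists_sampleLaw_le_of_sequence {M : Set (ProbabilityMeasure Ω)}
    (hM : UniformlyContinuousAtEmpty M) {P : ℕ → ProbabilityMeasure Ω} (hP : ∀ j, P j ∈ M) :
    ∀ (n : ℕ) (A : ℕ → Set (Fin n → Ω)), (∀ k, MeasurableSet (A k)) → Antitone A →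
      ⋂ k, A k = ∅ → ∀ ε : ENNReal, 0 < ε → ∃ k, ∀ j, sampleLaw n (P j) (A k) ≤ ε := by
  intro n
  induction n with
  | zero =>
    intro A _ _ hempty ε hε
    have : (fun i => i.elim0 : Fin 0 → Ω) ∉ ⋂ k, A k := by simp [hempty]
    obtain ⟨k, hk⟩ := not_forall.1 (mt Set.mem_iInter.2 this)
    refine ⟨k, fun j => ?_⟩
    have : A k = ∅ := Set.eq_empty_of_forall_notMem fun x hx => hk (by
      convert hx)
    simp [this]
  | succ n ih =>
    intro A hA hanti hempty ε hε
    have hε2 : 0 < ε / 2 := ENNReal.half_pos hε.ne'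
    set e := MeasurableEquiv.piFinSuccAbove (fun _ : Fin (n + 1) => Ω) 0 with he
    have hA' : ∀ k, MeasurableSet (e.symm ⁻¹' A k) := fun k => e.symm.measurable (hA k)
    set g : ℕ → Ω → ENNReal :=
      fun k x => ⨆ j, sampleLaw n (P j) (Prod.mk x ⁻¹' (e.symm ⁻¹' A k)) with hg
    have hgm : ∀ k, Measurable (g k) := fun k =>
      Measurable.iSup fun j => measurable_measure_prodMk_left (hA' k)
    obtain ⟨k, hk⟩ := hM (fun k => {x | ε / 2 < g k x})
      (fun k => measurableSet_lt measurable_const (hgm k))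
      (fun k l hkl x hx => lt_of_lt_of_le (show ε / 2 < g l x from hx)
        (iSup_mono fun j => measure_mono fun y hy => hanti hkl hy))
      (Set.eq_empty_of_forall_notMem fun x hx => by
        obtain ⟨k, hk⟩ := ih (fun k => Prod.mk x ⁻¹' (e.symm ⁻¹' A k))
          (fun k => measurable_prodMk_left (hA' k)) (fun k l hkl y hy => hanti hkl hy)
          (by rw [← Set.preimage_iInter, ← Set.preimage_iInter, hempty]; rfl) (ε / 2) hε2
        exact (Set.mem_iInter.1 hx k).not_ge (iSup_le hk))
      (ε / 2) hε2
    refine ⟨k, fun j => ?_⟩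
    have hmp := (measurePreserving_piFinSuccAbove
      (fun _ : Fin (n + 1) => (P j : Measure Ω)) 0).symm
    calc sampleLaw (n + 1) (P j) (A k)
        = ((P j : Measure Ω).prod (sampleLaw n (P j))) (e.symm ⁻¹' A k) :=
          (hmp.measure_preimage (hA k).nullMeasurableSet).symm
      _ = ∫⁻ x, sampleLaw n (P j) (Prod.mk x ⁻¹' (e.symm ⁻¹' A k)) ∂(P j : Measure Ω) :=
          Measure.prod_apply (hA' k)
      -- A section has mass at most `ε / 2` where `g k x ≤ ε / 2`, and at most `1` elsewhere.
      _ ≤ ∫⁻ x, (ε / 2 + {x | ε / 2 < g k x}.indicator 1 x) ∂(P j : Measure Ω) := by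
          refine lintegral_mono fun x => ?_
          by_cases hx : ε / 2 < g k x
          · rw [Set.indicator_of_mem (by exact hx)]
            exact prob_le_one.trans le_add_self
          · exact ((le_iSup (fun j => sampleLaw n (P j) (Prod.mk x ⁻¹' (e.symm ⁻¹' A k))) j).trans
              (not_lt.1 hx)).trans le_self_add
      _ = ε / 2 + (P j : Measure Ω) {x | ε / 2 < g k x} := by
          rw [lintegral_add_left measurable_const,
            lintegral_indicator_one (measurableSet_lt measurable_const (hgm k))]
          simp
      _ ≤ ε / 2 + ε / 2 := by gcongr; exact hk _ (hP j)
      _ = ε := ENNReal.add_halves ε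

/-- A failure for every `k` yields one bad measure per `k`, hence a sequence contradicting the
previous lemma. -/
lemma UniformlyContinuousAtEmpty.sampleLaw {M : Set (ProbabilityMeasure Ω)}
    (hM : UniformlyContinuousAtEmpty M) {n : ℕ} {A : ℕ → Set (Fin n → Ω)}
    (hA : ∀ k, MeasurableSet (A k)) (hanti : Antitone A) (hempty : ⋂ k, A k = ∅)
    {ε : ENNReal} (hε : 0 < ε) : ∃ k, ∀ P ∈ M, sampleLaw n P (A k) ≤ ε := by
  by_contra! h
  choose P hP hlt using h
  obtain ⟨k, hk⟩ := exists_sampleLaw_le_of_sequence hM hP n A hA hanti hempty ε hε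
  exact (hlt k).not_ge (hk k)

/-! ### τ-continuity of the error probabilities and indistinguishability -/

/-- On rectangles the function is a finite product of τ-continuous ones. For disjoint unions the
tails decrease to `∅`, so the partial sums converge uniformly on `M`. -/
lemma continuousOn_sampleLaw_real {M : Set (ProbabilityMeasure Ω)}
    (hM : UniformlyContinuousAtEmpty M) {n : ℕ} {A : Set (Fin n → Ω)} (hA : MeasurableSet A) :
    @ContinuousOn _ _ (tauTopology Ω) _ (fun P => (sampleLaw n P).real A) M := by
  let _ := tauTopology Ω
  refine MeasurableSpace.induction_on_inter
    (C := fun A _ => ContinuousOn (fun P => (sampleLaw n P).real A) M)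
    generateFrom_pi.symm isPiSystem_pi ?_ (fun t ht => ?_) (fun t ht ih => ?_)
    (fun f hd hf ih => ?_) A hA
  · simpa using continuousOn_const
  · obtain ⟨s, hs, rfl⟩ := ht
    have : (fun P : ProbabilityMeasure Ω => (sampleLaw n P).real (Set.univ.pi s)) =
        fun P : ProbabilityMeasure Ω => ∏ i, (P : Measure Ω).real (s i) := by
      ext P
      simp [measureReal_def, SetwiseTesting.sampleLaw, Measure.pi_pi, ENNReal.toReal_prod]
    rw [this]
    exact (continuous_finsetProd _ fun i _ =>
      continuous_real_tau (hs i (Set.mem_univ i))).continuousOn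
  · simp only [probReal_compl_eq_one_sub ht]
    exact continuousOn_const.sub ih
  · have hsum : ∀ (k : ℕ) (P : ProbabilityMeasure Ω), (sampleLaw n P).real (⋃ i, f i) =
        ∑ i ∈ Finset.range k, (sampleLaw n P).real (f i) +
          (sampleLaw n P).real (⋃ i ≥ k, f i) := by
      intro k P
      have hU : ⋃ i, f i = (⋃ i ∈ Finset.range k, f i) ∪ ⋃ i ≥ k, f i := by
        ext x
        simp only [Set.mem_iUnion, Set.mem_union, Finset.mem_range, exists_prop, ge_iff_le]
        constructor
        · rintro ⟨i, hi⟩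
          exact (lt_or_ge i k).imp (fun h => ⟨i, h, hi⟩) fun h => ⟨i, h, hi⟩
        · rintro (⟨i, -, hi⟩ | ⟨i, -, hi⟩) <;> exact ⟨i, hi⟩
      rw [hU, measureReal_union ?_ (.iUnion fun i => .iUnion fun _ => hf i) (measure_ne_top _ _)
          (measure_ne_top _ _),
        measureReal_biUnion_finset (fun i _ j _ hij => hd hij) fun i _ => hf i]
      simp only [Set.disjoint_iUnion_left, Set.disjoint_iUnion_right, Finset.mem_range]
      exact fun i hi j hj => hd (by omega)
    have htail : ⋂ k, ⋃ i ≥ k, f i = ∅ := by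
      refine Set.eq_empty_of_forall_notMem fun x hx => ?_
      simp only [Set.mem_iInter, Set.mem_iUnion] at hx
      obtain ⟨i, -, hi⟩ := hx 0
      obtain ⟨j, hj, hj'⟩ := hx (i + 1)
      exact Set.disjoint_left.1 (hd (show i ≠ j by omega)) hi hj'
    have hanti : Antitone fun k => ⋃ i ≥ k, f i := fun k l hkl =>
      Set.biUnion_subset_biUnion_left fun i (hi : l ≤ i) => hkl.trans hi
    refine TendstoUniformlyOn.continuousOn (p := atTop)
      (F := fun k P => ∑ i ∈ Finset.range k, (sampleLaw n P).real (f i)) ?_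
      (Frequently.of_forall fun k => continuousOn_finsetSum _ fun i _ => ih i)
    rw [Metric.tendstoUniformlyOn_iff]
    intro ε hε
    obtain ⟨k, hk⟩ := hM.sampleLaw (fun k => .iUnion fun i => .iUnion fun _ => hf i) hanti htail
      (ENNReal.ofReal_pos.2 (half_pos hε))
    filter_upwards [eventually_ge_atTop k] with l hl P hP
    rw [hsum l P, Real.dist_eq, add_sub_cancel_left, abs_of_nonneg measureReal_nonneg]
    refine (measureReal_mono (hanti hl) (measure_ne_top _ _)).trans_lt ((ENNReal.toReal_le_of_le_ofReal
      (half_pos hε).le (hk P hP)).trans_lt (half_lt_self hε))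

lemma sum_range_indicator_eq_floor {t : ℝ} (ht : 0 ≤ t) {m : ℕ} (htm : t ≤ m) :
    ∑ j ∈ Finset.range m, (if ((j : ℝ) + 1) ≤ t then (1 : ℝ) else 0) = ⌊t⌋₊ := by
  rw [Finset.sum_boole]
  congr 1
  have : (Finset.range m).filter (fun j : ℕ => (j : ℝ) + 1 ≤ t) = Finset.range ⌊t⌋₊ := by
    ext j
    have h : (j : ℝ) + 1 ≤ t ↔ j + 1 ≤ ⌊t⌋₊ := by
      rw [Nat.le_floor_iff ht]; push_cast; rfl
    have h2 : ⌊t⌋₊ ≤ m := Nat.floor_le_of_le htm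
    simp only [Finset.mem_filter, Finset.mem_range, h]
    omega
  rw [this, Finset.card_range]

lemma SampleTest.integrable {n : ℕ} (K : SampleTest Ω n) (μ : Measure (Fin n → Ω))
    [IsFiniteMeasure μ] : Integrable K.toFun μ :=
  .of_bound K.measurable_toFun.aestronglyMeasurable 1
    (ae_of_all _ fun x => by rw [Real.norm_of_nonneg (K.nonneg x)]; exact K.le_one x)

/-- The step function `⌊m K⌋ / m`, a combination of indicators of level sets, is within `1 / m` of
`K`, so its integrals converge uniformly in `P`. -/
lemma continuousOn_typeIError {M : Set (ProbabilityMeasure Ω)}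
    (hM : UniformlyContinuousAtEmpty M) {n : ℕ} (K : SampleTest Ω n) :
    @ContinuousOn _ _ (tauTopology Ω) _ (fun P => typeIError K P) M := by
  let _ := tauTopology Ω
  have hmeas : ∀ m j : ℕ, MeasurableSet {x | (j : ℝ) + 1 ≤ m * K.toFun x} := fun m j =>
    measurableSet_le measurable_const (K.measurable_toFun.const_mul _)
  refine TendstoUniformlyOn.continuousOn (p := atTop)
    (F := fun (m : ℕ) P => (m : ℝ)⁻¹ * ∑ j ∈ Finset.range m,
      (sampleLaw n P).real {x | (j : ℝ) + 1 ≤ m * K.toFun x}) ?_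
    (Frequently.of_forall fun m => continuousOn_const.mul
      (continuousOn_finsetSum _ fun j _ => continuousOn_sampleLaw_real hM (hmeas m j)))
  rw [Metric.tendstoUniformlyOn_iff]
  intro ε hε
  filter_upwards [tendsto_inv_atTop_nhds_zero_nat (𝕜 := ℝ) |>.eventually_lt_const hε,
    eventually_gt_atTop 0] with m hm hm0 P _
  have hm0' : (0 : ℝ) < m := Nat.cast_pos.2 hm0
  have hint : (m : ℝ)⁻¹ * ∑ j ∈ Finset.range m,
      (sampleLaw n P).real {x | (j : ℝ) + 1 ≤ m * K.toFun x} =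
      ∫ x, (m : ℝ)⁻¹ * ∑ j ∈ Finset.range m,
        {x | (j : ℝ) + 1 ≤ m * K.toFun x}.indicator (fun _ => (1 : ℝ)) x ∂(sampleLaw n P) := by
    rw [integral_const_mul, integral_finsetSum _ fun j _ =>
      (integrable_const (1 : ℝ)).indicator (hmeas m j)]
    simp [integral_indicator (hmeas m _)]
  have hint' : Integrable (fun x => (m : ℝ)⁻¹ * ∑ j ∈ Finset.range m,
      {x | (j : ℝ) + 1 ≤ m * K.toFun x}.indicator (fun _ => (1 : ℝ)) x) (sampleLaw n P) :=
    (integrable_finsetSum _ fun j _ =>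
      (integrable_const (1 : ℝ)).indicator (hmeas m j)).const_mul _
  rw [hint, typeIError, Real.dist_eq, ← integral_sub (K.integrable _) hint', ← Real.norm_eq_abs]
  refine (norm_integral_le_of_norm_le_const (C := (m : ℝ)⁻¹) (ae_of_all _ fun x => ?_)).trans_lt
    (by simpa using hm)
  have h0 : 0 ≤ m * K.toFun x := mul_nonneg hm0'.le (K.nonneg x)
  have hfl := sum_range_indicator_eq_floor h0 (mul_le_of_le_one_right hm0'.le (K.le_one x))
  simp only [Set.indicator_apply, Set.mem_ofPred_eq]
  rw [hfl]
  have h1 := Nat.floor_le h0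
  have h2 := Nat.lt_floor_add_one (m * K.toFun x)
  have h3 : K.toFun x - (m : ℝ)⁻¹ * ⌊m * K.toFun x⌋₊ =
      (m : ℝ)⁻¹ * (m * K.toFun x - ⌊m * K.toFun x⌋₊) := by field_simp
  rw [h3, Real.norm_of_nonneg (mul_nonneg (inv_nonneg.2 hm0'.le) (by linarith))]
  exact mul_le_of_le_one_right (inv_nonneg.2 hm0'.le) (by linarith)

lemma typeIIError_eq {n : ℕ} (K : SampleTest Ω n) (P : ProbabilityMeasure Ω) :
    typeIIError K P = 1 - typeIError K P := by
  rw [typeIIError, integral_sub (integrable_const _) (K.integrable _)]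
  simp [typeIError]

lemma typeIError_nonneg {n : ℕ} (K : SampleTest Ω n) (P : ProbabilityMeasure Ω) :
    0 ≤ typeIError K P := integral_nonneg K.nonneg

lemma typeIError_le_one {n : ℕ} (K : SampleTest Ω n) (P : ProbabilityMeasure Ω) :
    typeIError K P ≤ 1 := by
  have : 0 ≤ typeIIError K P := integral_nonneg fun x => sub_nonneg.2 (K.le_one x)
  linarith [typeIIError_eq K P]

lemma typeIError_le_supTypeI {Θ₀ : Set (ProbabilityMeasure Ω)} {n : ℕ} (K : SampleTest Ω n)
    {P : ProbabilityMeasure Ω} (hP : P ∈ Θ₀) : typeIError K P ≤ supTypeI Θ₀ K :=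
  le_ciSup (f := fun P : Θ₀ => typeIError K P)
    ⟨1, Set.forall_mem_range.2 fun P => typeIError_le_one K P⟩ ⟨P, hP⟩

lemma typeIIError_le_supTypeII {Θ₁ : Set (ProbabilityMeasure Ω)} {n : ℕ} (K : SampleTest Ω n)
    {P : ProbabilityMeasure Ω} (hP : P ∈ Θ₁) : typeIIError K P ≤ supTypeII Θ₁ K :=
  le_ciSup (f := fun P : Θ₁ => typeIIError K P)
    ⟨1, Set.forall_mem_range.2 fun P => by
      linarith [typeIIError_eq K P, typeIError_nonneg K P]⟩ ⟨P, hP⟩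

lemma typeIError_mem_of_mem_tauClosure {Ψ : Set (ProbabilityMeasure Ω)}
    (hΨ : IsTauRelativelyCompact Ψ) {n : ℕ} (K : SampleTest Ω n) {P : ProbabilityMeasure Ω}
    (hP : P ∈ tauClosure Ψ) : typeIError K P ∈ closure ((fun Q => typeIError K Q) '' Ψ) := by
  let _ := tauTopology Ω
  have h : ContinuousWithinAt (fun Q => typeIError K Q) Ψ P :=
    (continuousOn_typeIError (uniformlyContinuousAtEmpty_of_isCompact hΨ) K P hP).mono
      subset_closure
  exact h.mem_closure_image hP

theorem indistinguishable_of_tauClosure_inter_nonempty {Θ₀ Θ₁ : Set (ProbabilityMeasure Ω)}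
    (h₀ : IsTauRelativelyCompact Θ₀) (h₁ : IsTauRelativelyCompact Θ₁)
    (h : (tauClosure Θ₀ ∩ tauClosure Θ₁).Nonempty) : Indistinguishable Θ₀ Θ₁ := by
  obtain ⟨P, hP₀, hP₁⟩ := h
  intro n _ K
  have hI : typeIError K P ≤ supTypeI Θ₀ K :=
    closure_minimal (t := Set.Iic (supTypeI Θ₀ K))
      (Set.image_subset_iff.2 fun Q hQ => typeIError_le_supTypeI K hQ) isClosed_Iic
      (typeIError_mem_of_mem_tauClosure h₀ K hP₀)
  have hII : 1 - supTypeII Θ₁ K ≤ typeIError K P :=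
    closure_minimal (t := Set.Ici (1 - supTypeII Θ₁ K)) (Set.image_subset_iff.2 fun Q hQ => by
      have := typeIIError_le_supTypeII K hQ
      rw [typeIIError_eq] at this
      show 1 - supTypeII Θ₁ K ≤ typeIError K Q
      linarith) isClosed_Ici (typeIError_mem_of_mem_tauClosure h₁ K hP₁)
  linarith

/-! ### Uniform separation by finitely many measurable sets -/

lemma tauTopology_eq_induced : tauTopology Ω =
    TopologicalSpace.induced (fun (P : ProbabilityMeasure Ω) (B : {B : Set Ω // MeasurableSet B}) =>
      (P : Measure Ω).real B) inferInstance := by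
  simp only [tauTopology, Pi.topologicalSpace, induced_iInf, induced_compose, iInf_subtype]
  rfl

/-- Two families of probability measures are uniformly separated if some finite collection of
measurable sets distinguishes any two members by a fixed positive amount. -/
def UniformlySeparated (M F : Set (ProbabilityMeasure Ω)) : Prop :=
  ∃ (I : Finset {B : Set Ω // MeasurableSet B}) (ε : ℝ), 0 < ε ∧ ∀ P ∈ M, ∀ Q ∈ F, ∃ B ∈ I,
    ε ≤ |(P : Measure Ω).real B - (Q : Measure Ω).real B|

lemma UniformlySeparated.symm {M F : Set (ProbabilityMeasure Ω)} (h : UniformlySeparated M F) :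
    UniformlySeparated F M := by
  obtain ⟨I, ε, hε, h⟩ := h
  refine ⟨I, ε, hε, fun P hP Q hQ => ?_⟩
  obtain ⟨B, hB, hle⟩ := h Q hQ P hP
  exact ⟨B, hB, by rwa [abs_sub_comm]⟩

lemma UniformlySeparated.mono {M M' F F' : Set (ProbabilityMeasure Ω)}
    (h : UniformlySeparated M F) (hM : M' ⊆ M) (hF : F' ⊆ F) : UniformlySeparated M' F' := by
  obtain ⟨I, ε, hε, h⟩ := h
  exact ⟨I, ε, hε, fun P hP Q hQ => h P (hM hP) Q (hF hQ)⟩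

lemma UniformlySeparated.union {M M' F : Set (ProbabilityMeasure Ω)}
    (h : UniformlySeparated M F) (h' : UniformlySeparated M' F) :
    UniformlySeparated (M ∪ M') F := by
  classical
  obtain ⟨I, ε, hε, h⟩ := h
  obtain ⟨J, δ, hδ, h'⟩ := h'
  refine ⟨I ∪ J, min ε δ, lt_min hε hδ, ?_⟩
  rintro P (hP | hP) Q hQ
  · obtain ⟨B, hB, hle⟩ := h P hP Q hQ
    exact ⟨B, Finset.mem_union_left _ hB, (min_le_left _ _).trans hle⟩
  · obtain ⟨B, hB, hle⟩ := h' P hP Q hQ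
    exact ⟨B, Finset.mem_union_right _ hB, (min_le_right _ _).trans hle⟩

lemma uniformlySeparated_singleton {P : ProbabilityMeasure Ω} {F : Set (ProbabilityMeasure Ω)}
    (hF : @IsClosed _ (tauTopology Ω) F) (hP : P ∉ F) : UniformlySeparated {P} F := by
  let _ := tauTopology Ω
  have h : Fᶜ ∈ @nhds _ (tauTopology Ω) P := hF.isOpen_compl.mem_nhds hP
  rw [tauTopology_eq_induced, nhds_induced, nhds_pi] at h
  obtain ⟨s, hs, hsF⟩ := h
  obtain ⟨I, hI, t, ht, hts⟩ := Filter.mem_pi.1 hs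
  have hball : ∀ᶠ ε in 𝓝[>] (0 : ℝ), ∀ B ∈ I,
      Metric.ball ((P : Measure Ω).real B) ε ⊆ t B := by
    refine (Filter.eventually_all_finite hI).2 fun B _ => ?_
    obtain ⟨δ, hδ, hδt⟩ := Metric.mem_nhds_iff.1 (ht B)
    filter_upwards [Ioo_mem_nhdsGT hδ] with ε hε
    exact (Metric.ball_subset_ball hε.2.le).trans hδt
  obtain ⟨ε, hεt, hε⟩ := (hball.and self_mem_nhdsWithin).exists
  refine ⟨hI.toFinset, ε, hε, ?_⟩
  rintro _ rfl Q hQ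
  by_contra! hlt
  refine hsF (hts fun B hB => hεt B hB ?_) hQ
  rw [Metric.mem_ball, Real.dist_eq, abs_sub_comm]
  exact hlt B (hI.mem_toFinset.2 hB)

/-- Halving `ε` leaves room to move `P`; this local form is what the compactness induction needs. -/
lemma UniformlySeparated.exists_nhds {P : ProbabilityMeasure Ω} {F : Set (ProbabilityMeasure Ω)}
    (h : UniformlySeparated {P} F) :
    ∃ U ∈ @nhds _ (tauTopology Ω) P, UniformlySeparated U F := by
  let _ := tauTopology Ω
  obtain ⟨I, ε, hε, h⟩ := h
  refine ⟨⋂ B ∈ I, {R | |(R : Measure Ω).real B - (P : Measure Ω).real B| < ε / 2},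
    (Filter.biInter_finset_mem _).2 fun B _ => ?_, I, ε / 2, half_pos hε, fun R hR Q hQ => ?_⟩
  · have hc := continuous_real_tau B.2
    exact (isOpen_lt (hc.sub continuous_const).abs continuous_const).mem_nhds
      (by simpa using hε)
  · obtain ⟨B, hB, hle⟩ := h P rfl Q hQ
    have hRB : |(R : Measure Ω).real B - (P : Measure Ω).real B| < ε / 2 :=
      Set.mem_iInter₂.1 hR B hB
    refine ⟨B, hB, ?_⟩
    have := abs_sub_le ((P : Measure Ω).real B) ((R : Measure Ω).real B) ((Q : Measure Ω).real B)
    rw [abs_sub_comm ((P : Measure Ω).real B) ((R : Measure Ω).real B)] at this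
    linarith

lemma uniformlySeparated_of_isCompact_of_isClosed {M F : Set (ProbabilityMeasure Ω)}
    (hM : @IsCompact _ (tauTopology Ω) M) (hF : @IsClosed _ (tauTopology Ω) F)
    (hMF : M ∩ F = ∅) : UniformlySeparated M F := by
  let _ := tauTopology Ω
  refine hM.induction_on (p := fun S => UniformlySeparated S F)
    ⟨∅, 1, one_pos, fun P hP => hP.elim⟩ (fun S T hST hT => hT.mono hST subset_rfl)
    (fun S T hS hT => hS.union hT) fun P hP => ?_
  obtain ⟨U, hU, h⟩ := (uniformlySeparated_singleton hF fun hPF =>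
    (hMF ▸ ⟨hP, hPF⟩ : P ∈ (∅ : Set _))).exists_nhds
  exact ⟨U, mem_nhdsWithin_of_mem_nhds hU, h⟩

lemma uniformlySeparated_of_tauClosure_inter_eq_empty {Θ₀ Θ₁ : Set (ProbabilityMeasure Ω)}
    (hc : IsTauRelativelyCompact Θ₀ ∨ IsTauRelativelyCompact Θ₁)
    (h : tauClosure Θ₀ ∩ tauClosure Θ₁ = ∅) : UniformlySeparated Θ₀ Θ₁ := by
  let _ := tauTopology Ω
  have hsep : UniformlySeparated (tauClosure Θ₀) (tauClosure Θ₁) := by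
    rcases hc with hc | hc
    · exact uniformlySeparated_of_isCompact_of_isClosed hc isClosed_closure h
    · exact (uniformlySeparated_of_isCompact_of_isClosed hc isClosed_closure
        (Set.inter_comm _ _ ▸ h)).symm
  exact hsep.mono subset_closure subset_closure

/-! ### Hoeffding bounds for empirical frequencies -/

lemma sampleLaw_real_sum_ge_le (P : ProbabilityMeasure Ω) {n : ℕ} (hn : 0 < n) {f : Ω → ℝ}
    (hf : Measurable f) {a : ℝ} (hfa : ∀ x, f x ∈ Set.Icc a (a + 1)) {δ : ℝ} (hδ : 0 ≤ δ) :
    (sampleLaw n P).real {x | n * δ ≤ ∑ i, (f (x i) - ∫ y, f y ∂(P : Measure Ω))} ≤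
      Real.exp (-2 * δ ^ 2 * n) := by
  have hmean : ∀ i : Fin n, ∫ x, f (x i) ∂(sampleLaw n P) = ∫ y, f y ∂(P : Measure Ω) := fun i =>
    integral_comp_eval (μ := fun _ : Fin n => (P : Measure Ω)) hf.aestronglyMeasurable
  have hind : ProbabilityTheory.iIndepFun
      (fun (i : Fin n) (x : Fin n → Ω) => f (x i) - ∫ y, f y ∂(P : Measure Ω)) (sampleLaw n P) :=
    ProbabilityTheory.iIndepFun_pi (μ := fun _ : Fin n => (P : Measure Ω))
      (X := fun _ y => f y - ∫ y, f y ∂(P : Measure Ω))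
      fun _ => (hf.sub_const _).aemeasurable
  have hsub : ∀ i : Fin n, ProbabilityTheory.HasSubgaussianMGF
      (fun x : Fin n → Ω => f (x i) - ∫ y, f y ∂(P : Measure Ω)) ((‖a + 1 - a‖₊ / 2) ^ 2)
      (sampleLaw n P) := fun i => by
    rw [← hmean i]
    exact ProbabilityTheory.hasSubgaussianMGF_of_mem_Icc
      (hf.comp (measurable_pi_apply i)).aemeasurable (ae_of_all _ fun x => hfa (x i))
  have h := ProbabilityTheory.HasSubgaussianMGF.measure_sum_ge_le_of_iIndepFun hind
    (s := Finset.univ) (fun i _ => hsub i) (ε := n * δ) (by positivity)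
  refine h.trans_eq ?_
  have hn' : (n : ℝ) ≠ 0 := by positivity
  congr 1
  simp
  field_simp

/-- The fraction of the observations that fall into `B`. -/
noncomputable def empiricalFrequency {n : ℕ} (B : Set Ω) (x : Fin n → Ω) : ℝ :=
  (∑ i, B.indicator (fun _ => (1 : ℝ)) (x i)) / n

lemma measurable_empiricalFrequency {n : ℕ} {B : Set Ω} (hB : MeasurableSet B) :
    Measurable (empiricalFrequency (n := n) B) :=
  (Finset.measurable_fun_sum _ fun i _ =>
    (measurable_const.indicator hB).comp (measurable_pi_apply i)).div_const _

lemma sampleLaw_real_abs_empiricalFrequency_sub_ge_le (P : ProbabilityMeasure Ω) {n : ℕ}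
    (hn : 0 < n) {B : Set Ω} (hB : MeasurableSet B) {δ : ℝ} (hδ : 0 ≤ δ) :
    (sampleLaw n P).real {x | δ ≤ |empiricalFrequency B x - (P : Measure Ω).real B|} ≤
      2 * Real.exp (-2 * δ ^ 2 * n) := by
  have hm : Measurable (B.indicator fun _ => (1 : ℝ)) := measurable_const.indicator hB
  have hint : ∫ y, B.indicator (fun _ => (1 : ℝ)) y ∂(P : Measure Ω) = (P : Measure Ω).real B := by
    simp [integral_indicator hB]
  have hn' : (0 : ℝ) < n := Nat.cast_pos.2 hn
  have h₁ := sampleLaw_real_sum_ge_le P hn hm (a := 0) (fun x => by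
    by_cases hx : x ∈ B <;> simp [hx]) hδ
  -- The lower tail is the upper tail of the negated indicator, with values in `[-1, 0]`.
  have h₂ := sampleLaw_real_sum_ge_le P hn hm.neg (a := -1) (fun x => by
    by_cases hx : x ∈ B <;> simp [hx]) hδ
  have hsum : ∀ x : Fin n → Ω, ∑ i, (B.indicator (fun _ => (1 : ℝ)) (x i) -
      (P : Measure Ω).real B) = n * (empiricalFrequency B x - (P : Measure Ω).real B) := by
    intro x
    simp only [empiricalFrequency, Finset.sum_sub_distrib, Finset.sum_const, Finset.card_univ,
      Fintype.card_fin, nsmul_eq_mul]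
    field_simp
  simp only [Pi.neg_apply, integral_neg, hint] at h₁ h₂
  calc _ ≤ (sampleLaw n P).real
          ({x | n * δ ≤ ∑ i, (B.indicator (fun _ => (1 : ℝ)) (x i) - (P : Measure Ω).real B)} ∪
            {x | n * δ ≤ ∑ i, (-B.indicator (fun _ => (1 : ℝ)) (x i) -
              -(P : Measure Ω).real B)}) := by
        refine measureReal_mono fun x hx => ?_
        rcases le_abs.1 (show δ ≤ |_| from hx) with h | h
        · refine Or.inl ?_
          rw [Set.mem_ofPred_eq, hsum]
          exact mul_le_mul_of_nonneg_left h hn'.le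
        · refine Or.inr ?_
          rw [Set.mem_ofPred_eq]
          simp only [neg_sub_neg, ← neg_sub (B.indicator _ _), Finset.sum_neg_distrib, hsum]
          rw [← mul_neg]
          exact mul_le_mul_of_nonneg_left h hn'.le
    _ ≤ _ := (measureReal_union_le _ _).trans (by linarith)

/-! ### Exponentially consistent tests -/

/-- The nonrandomized test with a given rejection region. -/
noncomputable def SampleTest.ofRegion {n : ℕ} (R : Set (Fin n → Ω)) (hR : MeasurableSet R) : SampleTest Ω n where
  toFun := R.indicator fun _ => 1
  measurable_toFun := measurable_const.indicator hR
  nonneg := Set.indicator_nonneg fun _ _ => zero_le_one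
  le_one := Set.indicator_le_self' (fun _ _ => zero_le_one)

lemma typeIError_ofRegion {n : ℕ} {R : Set (Fin n → Ω)} (hR : MeasurableSet R)
    (P : ProbabilityMeasure Ω) :
    typeIError (SampleTest.ofRegion R hR) P = (sampleLaw n P).real R := by
  simp [typeIError, SampleTest.ofRegion, integral_indicator hR]

lemma typeIIError_ofRegion {n : ℕ} {R : Set (Fin n → Ω)} (hR : MeasurableSet R)
    (P : ProbabilityMeasure Ω) :
    typeIIError (SampleTest.ofRegion R hR) P = (sampleLaw n P).real Rᶜ := by
  rw [typeIIError_eq, typeIError_ofRegion, probReal_compl_eq_one_sub hR]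

lemma supTypeI_le {Θ₀ : Set (ProbabilityMeasure Ω)} {n : ℕ} {K : SampleTest Ω n} {b : ℝ}
    (hb : 0 ≤ b) (h : ∀ P ∈ Θ₀, typeIError K P ≤ b) : supTypeI Θ₀ K ≤ b :=
  Real.iSup_le (fun P => h P P.2) hb

lemma supTypeII_le {Θ₁ : Set (ProbabilityMeasure Ω)} {n : ℕ} {K : SampleTest Ω n} {b : ℝ}
    (hb : 0 ≤ b) (h : ∀ P ∈ Θ₁, typeIIError K P ≤ b) : supTypeII Θ₁ K ≤ b :=
  Real.iSup_le (fun P => h P P.2) hb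

lemma supTypeII_nonneg (Θ₁ : Set (ProbabilityMeasure Ω)) {n : ℕ} (K : SampleTest Ω n) :
    0 ≤ supTypeII Θ₁ K :=
  Real.iSup_nonneg fun _ => integral_nonneg fun x => sub_nonneg.2 (K.le_one x)

/-- The test rejects when the vector of empirical frequencies is at sup-distance at least `ε / 2`
from the vectors of `Θ₀`. Either error forces some frequency to deviate by `ε / 2` from its true
probability; a union bound over `I` gives `C`. -/
lemma UniformlySeparated.exists_tests {Θ₀ Θ₁ : Set (ProbabilityMeasure Ω)}
    (h : UniformlySeparated Θ₀ Θ₁) :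
    ∃ (K : (n : ℕ) → SampleTest Ω n) (C c : ℝ), 0 ≤ C ∧ 0 < c ∧ ∀ n, 0 < n →
      supTypeI Θ₀ (K n) ≤ C * Real.exp (-c * n) ∧
      supTypeII Θ₁ (K n) ≤ C * Real.exp (-c * n) := by
  -- `Metric.infDist` to the empty set is `0`, so the distance test would never reject; here one
  -- always rejects.
  rcases Θ₀.eq_empty_or_nonempty with rfl | hne
  · refine ⟨fun n => .ofRegion Set.univ .univ, 0, 1, le_rfl, one_pos, fun n _ =>
      ⟨supTypeI_le (by simp) fun P hP => hP.elim, supTypeII_le (by simp) fun P _ => ?_⟩⟩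
    simp [typeIIError_ofRegion]
  obtain ⟨I, ε, hε, hsep⟩ := h
  let V : Set (I → ℝ) := (fun P : ProbabilityMeasure Ω => fun B : I => (P : Measure Ω).real B) '' Θ₀
  have hV : V.Nonempty := hne.image _
  let F : (n : ℕ) → (Fin n → Ω) → I → ℝ := fun n x B => empiricalFrequency (B : Set Ω) x
  have hF : ∀ n, Measurable (F n) := fun n =>
    measurable_pi_lambda _ fun B => measurable_empiricalFrequency B.1.2
  let R : (n : ℕ) → Set (Fin n → Ω) := fun n => {x | ε / 2 ≤ Metric.infDist (F n x) V}
  have hR : ∀ n, MeasurableSet (R n) := fun n =>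
    measurableSet_le measurable_const ((Metric.continuous_infDist_pt V).measurable.comp (hF n))
  have hdev : ∀ n, 0 < n → ∀ (P : ProbabilityMeasure Ω) (S : Set (Fin n → Ω)),
      (∀ x ∈ S, ∃ B : I, ε / 2 ≤ |empiricalFrequency (B : Set Ω) x - (P : Measure Ω).real B|) →
      (sampleLaw n P).real S ≤ 2 * I.card * Real.exp (-(2 * (ε / 2) ^ 2) * n) := by
    intro n hn P S hS
    calc (sampleLaw n P).real S
        ≤ (sampleLaw n P).real (⋃ B : I,
            {x | ε / 2 ≤ |empiricalFrequency (B : Set Ω) x - (P : Measure Ω).real B|}) :=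
          measureReal_mono fun x hx => Set.mem_iUnion.2 (hS x hx)
      _ ≤ ∑ B : I, (sampleLaw n P).real
            {x | ε / 2 ≤ |empiricalFrequency (B : Set Ω) x - (P : Measure Ω).real B|} :=
          measureReal_iUnion_fintype_le _
      _ ≤ ∑ B : I, 2 * Real.exp (-2 * (ε / 2) ^ 2 * n) :=
          Finset.sum_le_sum fun B _ =>
            sampleLaw_real_abs_empiricalFrequency_sub_ge_le P hn B.1.2 (half_pos hε).le
      _ = _ := by simp; ring
  refine ⟨fun n => .ofRegion (R n) (hR n), 2 * I.card, 2 * (ε / 2) ^ 2, by positivity,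
    by positivity, fun n hn => ⟨supTypeI_le (by positivity) fun P hP => ?_,
      supTypeII_le (by positivity) fun Q hQ => ?_⟩⟩
  · rw [typeIError_ofRegion]
    refine hdev n hn P _ fun x hx => ?_
    by_contra! hlt
    refine (Metric.infDist_le_dist_of_mem (Set.mem_image_of_mem _ hP)).not_gt
      (lt_of_lt_of_le ?_ (show ε / 2 ≤ Metric.infDist (F n x) V from hx))
    exact (dist_pi_lt_iff (half_pos hε)).2 hlt
  · rw [typeIIError_ofRegion]
    refine hdev n hn Q _ fun x hx => ?_
    obtain ⟨_, ⟨P, hP, rfl⟩, hlt⟩ := (Metric.infDist_lt_iff hV).1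
      (not_le.1 (show ¬ε / 2 ≤ Metric.infDist (F n x) V from hx))
    obtain ⟨B, hB, hle⟩ := hsep P hP Q hQ
    have hxB : |empiricalFrequency (B : Set Ω) x - (P : Measure Ω).real B| < ε / 2 :=
      (dist_pi_lt_iff (half_pos hε)).1 hlt ⟨B, hB⟩
    refine ⟨⟨B, hB⟩, ?_⟩
    have := abs_sub_le ((P : Measure Ω).real B) (empiricalFrequency (B : Set Ω) x)
      ((Q : Measure Ω).real B)
    rw [abs_sub_comm ((P : Measure Ω).real B) (empiricalFrequency _ _)] at this
    dsimp only
    linarith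

lemma UniformlySeparated.exists_exponential_tests {Θ₀ Θ₁ : Set (ProbabilityMeasure Ω)}
    (h : UniformlySeparated Θ₀ Θ₁) :
    ∃ (K : (n : ℕ) → SampleTest Ω n) (c : ℝ) (n₀ : ℕ), 0 < c ∧ ∀ n : ℕ, n₀ < n →
      supTypeI Θ₀ (K n) ≤ Real.exp (-c * n) ∧ supTypeII Θ₁ (K n) ≤ Real.exp (-c * n) := by
  obtain ⟨K, C, c, hC, hc, hK⟩ := h.exists_tests
  have hlim : Tendsto (fun n : ℕ => Real.exp (c / 2 * n)) atTop atTop :=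
    Real.tendsto_exp_atTop.comp (tendsto_natCast_atTop_atTop.const_mul_atTop (half_pos hc))
  obtain ⟨n₀, hn₀⟩ := eventually_atTop.1 (hlim.eventually_ge_atTop C)
  -- Half of the exponential rate is spent on absorbing `C`.
  refine ⟨K, c / 2, n₀, half_pos hc, fun n hn => ?_⟩
  have hle : C * Real.exp (-c * n) ≤ Real.exp (-(c / 2) * n) := by
    calc C * Real.exp (-c * n) ≤ Real.exp (c / 2 * n) * Real.exp (-c * n) := by
          gcongr; exact hn₀ n hn.le
      _ = Real.exp (-(c / 2) * n) := by rw [← Real.exp_add]; congr 1; ring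
  obtain ⟨h₀, h₁⟩ := hK n (by omega)
  exact ⟨h₀.trans hle, h₁.trans hle⟩

lemma tendsto_exp_neg_mul_natCast {c : ℝ} (hc : 0 < c) :
    Tendsto (fun n : ℕ => Real.exp (-c * n)) atTop (𝓝 0) :=
  Real.tendsto_exp_atBot.comp
    (tendsto_natCast_atTop_atTop.const_mul_atTop_of_neg (neg_neg_of_pos hc))

lemma UniformlySeparated.distinguishable {Θ₀ Θ₁ : Set (ProbabilityMeasure Ω)}
    (h : UniformlySeparated Θ₀ Θ₁) : Distinguishable Θ₀ Θ₁ := by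
  intro a ha _
  obtain ⟨K, c, n₀, hc, hK⟩ := h.exists_exponential_tests
  have hlim := tendsto_exp_neg_mul_natCast hc
  obtain ⟨n₁, hn₁⟩ := eventually_atTop.1 (hlim.eventually_lt_const ha)
  -- Never rejecting keeps the level below `a` for the small `n` that the exponential bound does not
  -- cover.
  refine ⟨fun n => if max n₀ n₁ < n then K n else .ofRegion ∅ .empty, fun n _ => ?_, ?_⟩
  · dsimp only
    split_ifs with hn
    · exact (hK n (by omega)).1.trans_lt (hn₁ n (by omega))
    · exact (supTypeI_le le_rfl fun P _ => by simp [typeIError_ofRegion]).trans_lt ha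
  · refine squeeze_zero' (Eventually.of_forall fun n => supTypeII_nonneg _ _) ?_ hlim
    filter_upwards [eventually_gt_atTop (max n₀ n₁)] with n hn
    rw [if_pos hn]
    exact (hK n (by omega)).2

end SetwiseTesting

theorem theorem2p1 {Ω : Type*} [TopologicalSpace Ω] [T2Space Ω] [MeasurableSpace Ω] [BorelSpace Ω]
    (Θ₀ Θ₁ : Set (ProbabilityMeasure Ω)) :
    (SetwiseTesting.IsTauRelativelyCompact Θ₀ → SetwiseTesting.IsTauRelativelyCompact Θ₁ →
      (SetwiseTesting.tauClosure Θ₀ ∩ SetwiseTesting.tauClosure Θ₁).Nonempty →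
      SetwiseTesting.Indistinguishable Θ₀ Θ₁) ∧
    ((SetwiseTesting.IsTauRelativelyCompact Θ₀ ∨ SetwiseTesting.IsTauRelativelyCompact Θ₁) →
      SetwiseTesting.tauClosure Θ₀ ∩ SetwiseTesting.tauClosure Θ₁ = ∅ →
      SetwiseTesting.Distinguishable Θ₀ Θ₁ ∧
        ∃ (K : (n : ℕ) → SetwiseTesting.SampleTest Ω n) (c : ℝ) (n₀ : ℕ), 0 < c ∧
          ∀ n : ℕ, n₀ < n →
            SetwiseTesting.supTypeI Θ₀ (K n) ≤ Real.exp (-c * n) ∧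
            SetwiseTesting.supTypeII Θ₁ (K n) ≤ Real.exp (-c * n)) := by
  exact ⟨SetwiseTesting.indistinguishable_of_tauClosure_inter_nonempty, fun hc h =>
    have hsep := SetwiseTesting.uniformlySeparated_of_tauClosure_inter_eq_empty hc h
    ⟨hsep.distinguishable, hsep.exists_exponential_tests⟩⟩
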